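/- Let $\mathcal H_A$ and $\mathcal H_B$ be arbitrary complex Hilbert spaces (of any dimension, possibly non-separable), and let $\mathcal H_A\otimes\mathcal H_B$ be their Hilbert space tensor product. A state on a Hilbert space is a positive trace-class operator of trace $1$. A state on $\mathcal H_A\otimes\mathcal H_B$ is called separable if it is a limit in trace norm of finite convex combinations of product states $\rho_A\otimes\rho_B$, where $\rho_A$ and $\rho_B$ are states on $\mathcal H_A$ and $\mathcal H_B$; otherwise it is called entangled. For a bounded Hermitian operator $A$ on $\mathcal H_A\otimes\mathcal H_B$ put $$f_{AB}(A)=\sup\{\langle a\otimes b, A(a\otimes b)\rangle : a\in\mathcal H_A,\ b\in\mathcal H_B,\ \|a\|=\|b\|=1\}.$$ Then a state $\rho$ on $\mathcal H_A\otimes\mathcal H_B$ is entangled if and only if there is a bounded Hermitian operator $A$ on $\mathcal H_A\otimes\mathcal H_B$ with $f_{AB}(A)<\operatorname{tr}(\rho A)$. -/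

import Mathlib

open scoped TensorProduct ENNReal InnerProductSpace

noncomputable section

namespace QuantumSystem

universe u v

/-! ### Trace, trace norm and states on an arbitrary complex Hilbert space -/

section Hilbert

variable (H : Type u) [NormedAddCommGroup H] [InnerProductSpace ℂ H] [CompleteSpace H]

/-- Index set of a fixed orthonormal (Hilbert) basis of `H`; it may be uncountable. -/
def basisIndex : Set H := (exists_hilbertBasis ℂ H).choose

/-- A fixed orthonormal (Hilbert) basis of `H`. Traces of trace-class operators and traces in
`[0, ∞]` of positive operators do not depend on its choice. -/
def basis : HilbertBasis (basisIndex H) ℂ H := (exists_hilbertBasis ℂ H).choose_spec.choose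

variable {H}

/-- The trace `∑ᵢ ⟨eᵢ, T eᵢ⟩` of an operator (meaningful for trace-class operators, for which the
sum converges absolutely). -/
def trace (T : H →L[ℂ] H) : ℂ := ∑' i, ⟪basis H i, T (basis H i)⟫_ℂ

/-- The trace norm `tr |T| = ∑ᵢ ⟨eᵢ, |T| eᵢ⟩ ∈ [0, ∞]`, with `|T| = (T† T)^{1/2}`; it is finite
exactly on the trace-class operators. -/
def traceNorm (T : H →L[ℂ] H) : ℝ≥0∞ :=
  ∑' i, ENNReal.ofReal (⟪basis H i, CFC.abs T (basis H i)⟫_ℂ).re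

/-- A quantum state (density operator): a positive bounded operator of trace one. -/
structure IsState (ρ : H →L[ℂ] H) : Prop where
  isPositive : ρ.IsPositive
  hasSum_trace : HasSum (fun i => ⟪basis H i, ρ (basis H i)⟫_ℂ) 1

end Hilbert

/-! ### Bipartite systems -/

/-- The Hilbert space tensor product: the completion of the algebraic tensor product for the inner
product `⟨a ⊗ b, a' ⊗ b'⟩ = ⟨a, a'⟩ ⟨b, b'⟩`. -/
abbrev HilbertTensor (HA : Type u) (HB : Type v)
    [NormedAddCommGroup HA] [InnerProductSpace ℂ HA]
    [NormedAddCommGroup HB] [InnerProductSpace ℂ HB] : Type (max u v) :=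
  UniformSpace.Completion (HA ⊗[ℂ] HB)

section Bipartite

variable {HA : Type u} {HB : Type v}
  [NormedAddCommGroup HA] [InnerProductSpace ℂ HA]
  [NormedAddCommGroup HB] [InnerProductSpace ℂ HB]

/-- The product vector `|a, b⟩ = a ⊗ b`. -/
def prodVec (a : HA) (b : HB) : HilbertTensor HA HB :=
  ((a ⊗ₜ[ℂ] b : HA ⊗[ℂ] HB) : UniformSpace.Completion (HA ⊗[ℂ] HB))

/-- The tensor product `S ⊗ T` of bounded operators, as a bounded operator. -/
def tensorOp (S : HA →L[ℂ] HA) (T : HB →L[ℂ] HB) : HilbertTensor HA HB →L[ℂ] HilbertTensor HA HB :=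
  (TensorProduct.mapL S T).completion

/-- `f_AB(A)`: the supremum of `⟨a, b| A |a, b⟩` over normalized `a` and `b`. -/
def fAB (A : HilbertTensor HA HB →L[ℂ] HilbertTensor HA HB) : ℝ :=
  sSup {x : ℝ | ∃ (a : HA) (b : HB), ‖a‖ = 1 ∧ ‖b‖ = 1 ∧
    x = (⟪prodVec a b, A (prodVec a b)⟫_ℂ).re}

variable [CompleteSpace HA] [CompleteSpace HB]

variable (HA HB) in
/-- The product states `ρ_A ⊗ ρ_B`. -/
def productStates : Set (HilbertTensor HA HB →L[ℂ] HilbertTensor HA HB) :=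
  {τ | ∃ (ρA : HA →L[ℂ] HA) (ρB : HB →L[ℂ] HB), IsState ρA ∧ IsState ρB ∧ τ = tensorOp ρA ρB}

/-- A state is separable if it is a trace-norm limit of finite convex combinations of product
states. -/
def IsSeparable (σ : HilbertTensor HA HB →L[ℂ] HilbertTensor HA HB) : Prop :=
  IsState σ ∧ ∀ ε : ℝ≥0∞, 0 < ε → ∃ τ ∈ convexHull ℝ (productStates HA HB), traceNorm (σ - τ) < ε

/-- A state is entangled if it is not separable. -/
def IsEntangled (ρ : HilbertTensor HA HB →L[ℂ] HilbertTensor HA HB) : Prop :=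
  IsState ρ ∧ ¬ IsSeparable ρ

end Bipartite

end QuantumSystem

end

/-!
The proof pairs operators with bounded operators through the trace and applies the Hahn-Banach
theorem in the space `E` of bounded functionals on `H →L[ℂ] H`, a normed space that
contains the trace class as the functionals `B ↦ tr (ρ B)`.

A positive operator `T` with summable diagonal is a sum `∑ᵢ |rᵢ⟩⟨rᵢ|` with `∑ᵢ ‖rᵢ‖² = tr T`: take
`rᵢ = √T eᵢ` (`exists_hasSum_rankOne`). No spectral decomposition is needed. For such a sum,
`tr (T A) = ∑ᵢ ⟨rᵢ, A rᵢ⟩` in every Hilbert basis (`hasSum_trace_comp_of_hasSum_rankOne`), and the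
tensor product of two such sums is the sum over the product vectors (`hasSum_rankOne_tensorOp`).

If `ρ` is separable, then `Re tr (ρ A) ≤ f_AB(A)` for every `A`: a product state is a sum of
`|aᵢ ⊗ bⱼ⟩⟨aᵢ ⊗ bⱼ|` with `∑ ‖aᵢ‖² ‖bⱼ‖² = 1`, so it satisfies the inequality; the inequality is
convex; and it passes to trace norm limits because `|tr (T A)| ≤ ‖A‖ ‖T‖₁` for self-adjoint `T`,
which follows from `T = T⁺ - T⁻` and `|T| = T⁺ + T⁻` (`norm_trace_comp_le`).

If `ρ` is entangled, let `ω_ρ ∈ E` be the functional `B ↦ tr (ρ B)`. A functional `ω` *represents*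
`T` if `ω |x⟩⟨y| = ⟨y, T x⟩`, and then `‖T‖₁ ≤ ‖ω‖` (`Represents.traceNorm_le`). Hence `ω_ρ` is not in
the norm closure of the convex hull of the functionals `B ↦ ⟨a ⊗ b, B (a ⊗ b)⟩` with unit vectors
`a`, `b`, for otherwise `ρ` would be separable. A continuous functional `F` on `E` separates them,
and the bounded sesquilinear form `F (B ↦ ⟨y, B x⟩)` is `⟨y, B₀ x⟩` for an operator `B₀`. The
self-adjoint part `A` of `B₀` is the witness; that `Re tr (ρ A) = Re F ω_ρ` follows from the norm
convergence of `ω_ρ = ∑ᵢ (B ↦ ⟨rᵢ, B rᵢ⟩)`.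
-/

namespace QuantumSystem

open InnerProductSpace ContinuousLinearMap

universe u v

section Hilbert

variable {H : Type u} [NormedAddCommGroup H] [InnerProductSpace ℂ H] [CompleteSpace H]

/-! ### The trace norm is bounded by the norm of a representing functional -/

/-- An approximate polar decomposition: `|T|` is within `δ` of `W T` for a contraction `W`. The choice
`W = (|T| + δ)⁻¹ T†` stays in the C⋆-algebra, where an exact partial isometry need not exist. -/
theorem exists_contraction_near_abs {A : Type*} [CStarAlgebra A] [PartialOrder A]
    [StarOrderedRing A] (T : A) {δ : ℝ} (hδ : 0 < δ) :
    ∃ W : A, ‖W‖ ≤ 1 ∧ ‖CFC.abs T - W * T‖ ≤ δ := by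
  set P := CFC.abs T with hP
  have hP0 : 0 ≤ P := CFC.abs_nonneg T
  have hPsa : IsSelfAdjoint P := hP0.isSelfAdjoint
  have hsp : ∀ t ∈ spectrum ℝ P, 0 ≤ t := fun t ht => spectrum_nonneg_of_nonneg hP0 ht
  have hcont : ContinuousOn (fun t : ℝ => (t + δ)⁻¹) (spectrum ℝ P) :=
    (continuousOn_id.add continuousOn_const).inv₀ fun t ht => by
      have := hsp t ht; change t + δ ≠ 0; positivity
  set G := cfc (fun t : ℝ => (t + δ)⁻¹) P with hG
  have hGsa : star G = G := (cfc_predicate (fun t : ℝ => (t + δ)⁻¹) P : IsSelfAdjoint G)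
  have hPP : star T * T = P * P := (CFC.abs_mul_abs T).symm
  have hid : cfc (fun t : ℝ => t) P = P := cfc_id' ℝ P
  have hGP : G * P = cfc (fun t : ℝ => (t + δ)⁻¹ * t) P := by
    conv_lhs => rw [← hid]
    rw [cfc_mul (fun t : ℝ => (t + δ)⁻¹) (fun t => t) P hcont continuousOn_id]
  have hGPP : G * (P * P) = cfc (fun t : ℝ => (t + δ)⁻¹ * t * t) P := by
    rw [← mul_assoc, hGP, cfc_mul (fun t : ℝ => (t + δ)⁻¹ * t) (fun t => t) P
      (hcont.mul continuousOn_id) continuousOn_id, hid]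
  have hGP1 : ‖G * P‖ ≤ 1 := by
    rw [hGP]
    refine norm_cfc_le zero_le_one fun t ht => ?_
    have := hsp t ht
    rw [Real.norm_of_nonneg (by positivity), inv_mul_le_one₀ (by positivity)]
    linarith
  refine ⟨G * star T, ?_, ?_⟩
  · have h1 : (G * star T) * star (G * star T) = (G * P) * star (G * P) := by
      rw [star_mul, star_star, star_mul, hGsa, hPsa.star_eq]
      calc G * star T * (T * G) = G * (star T * T) * G := by simp only [mul_assoc]
        _ = _ := by rw [hPP]; simp only [mul_assoc]
    -- By the C⋆-identity, `‖G T†‖² = ‖G T† T G‖ = ‖G |T|‖²`.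
    have h2 : ‖G * star T‖ * ‖G * star T‖ = ‖G * P‖ * ‖G * P‖ := by
      rw [← CStarRing.norm_self_mul_star, h1, CStarRing.norm_self_mul_star]
    nlinarith [norm_nonneg (G * star T), norm_nonneg (G * P)]
  · have h3 : P - G * star T * T = cfc (fun t : ℝ => t - (t + δ)⁻¹ * t * t) P := by
      rw [cfc_sub (fun t : ℝ => t) (fun t => (t + δ)⁻¹ * t * t) P continuousOn_id
        ((hcont.mul continuousOn_id).mul continuousOn_id), hid, ← hGPP, mul_assoc, hPP]
    rw [h3]
    refine norm_cfc_le hδ.le fun t ht => ?_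
    have ht0 := hsp t ht
    have h4 : t - (t + δ)⁻¹ * t * t = (t + δ)⁻¹ * t * δ := by field_simp; ring
    rw [h4, Real.norm_of_nonneg (by positivity)]
    have : (t + δ)⁻¹ * t ≤ 1 := by
      rw [inv_mul_le_one₀ (by positivity)]; linarith
    nlinarith

omit [CompleteSpace H] in
/-- A finite sum of projections onto vectors of an orthonormal family is a contraction, by Bessel's
inequality. -/
theorem norm_sum_rankOne_le {ι : Type*} {e : ι → H} (he : Orthonormal ℂ e) (F : Finset ι) :
    ‖∑ i ∈ F, rankOne ℂ (e i) (e i)‖ ≤ 1 := by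
  refine opNorm_le_bound _ zero_le_one fun x => ?_
  have h1 : (∑ i ∈ F, rankOne ℂ (e i) (e i)) x = ∑ i ∈ F, ⟪e i, x⟫_ℂ • e i := by
    simp [sum_apply]
  have h2 : ‖∑ i ∈ F, ⟪e i, x⟫_ℂ • e i‖ ^ 2 = ∑ i ∈ F, ‖⟪e i, x⟫_ℂ‖ ^ 2 := by
    rw [← inner_self_eq_norm_sq (𝕜 := ℂ), he.inner_sum, map_sum]
    refine Finset.sum_congr rfl fun i _ => ?_
    rw [Complex.conj_mul', ← Complex.ofReal_pow]; rfl
  have h3 := he.sum_inner_products_le x (s := F)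
  rw [h1, one_mul]
  exact le_of_sq_le_sq (h2.trans_le h3) (norm_nonneg _)

/-- The functional `ω` on bounded operators represents the operator `T` if `ω |x⟩⟨y| = ⟨y, T x⟩` for
all `x`, `y`, that is, if `ω B = tr (T B)` for `B` of finite rank. Values of `ω` elsewhere are not
constrained. -/
def Represents (ω : StrongDual ℂ (H →L[ℂ] H)) (T : H →L[ℂ] H) : Prop :=
  ∀ x y, ω (rankOne ℂ x y) = ⟪y, T x⟫_ℂ

/-- The trace norm is at most the norm of any representing functional `ω`: with `W` a contraction such
that `|T| ≈ W T` and `P` a finite-rank projection onto basis vectors, the corresponding partial sum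
of `tr |T|` is close to `ω (P W)`. -/
theorem Represents.traceNorm_le {ω : StrongDual ℂ (H →L[ℂ] H)} {T : H →L[ℂ] H}
    (h : Represents ω T) : traceNorm T ≤ ENNReal.ofReal ‖ω‖ := by
  refine ENNReal.summable.tsum_le_of_sum_le fun F => ?_
  have hpos : ∀ i, 0 ≤ (⟪basis H i, CFC.abs T (basis H i)⟫_ℂ).re := fun i =>
    (nonneg_iff_isPositive _ |>.mp (CFC.abs_nonneg T)).re_inner_nonneg_right _
  rw [← ENNReal.ofReal_sum_of_nonneg fun i _ => hpos i]
  refine ENNReal.ofReal_le_ofReal (le_of_forall_pos_le_add fun η hη => ?_)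
  -- The error `δ` is shared by the `F.card` summands; the `+ 1` covers an empty `F`.
  obtain ⟨W, hW, hWT⟩ := exists_contraction_near_abs T (δ := η / (F.card + 1)) (by positivity)
  have hnorm := (basis H).orthonormal.norm_eq_one
  have h1 : ∀ i, (⟪basis H i, CFC.abs T (basis H i)⟫_ℂ).re ≤
      (⟪basis H i, W (T (basis H i))⟫_ℂ).re + η / (F.card + 1) := fun i => by
    have h2 : (⟪basis H i, (CFC.abs T - W * T) (basis H i)⟫_ℂ).re ≤ η / (F.card + 1) := by
      refine (Complex.re_le_norm _).trans ((norm_inner_le_norm _ _).trans ?_)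
      rw [hnorm, one_mul]
      exact (le_opNorm _ _).trans (by rw [hnorm, mul_one]; exact hWT)
    rw [sub_apply, inner_sub_right, Complex.sub_re] at h2
    have h3 : (W * T) (basis H i) = W (T (basis H i)) := rfl
    rw [h3] at h2
    linarith
  have h4 : ∑ i ∈ F, ⟪basis H i, W (T (basis H i))⟫_ℂ =
      ω ((∑ i ∈ F, rankOne ℂ (basis H i) (basis H i)) ∘L W) := by
    rw [finsetSum_comp, map_sum]
    refine Finset.sum_congr rfl fun i _ => ?_
    rw [rankOne_comp, h, adjoint_inner_left]
  have h5 : (∑ i ∈ F, (⟪basis H i, W (T (basis H i))⟫_ℂ).re) ≤ ‖ω‖ := by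
    rw [← Complex.re_sum, h4]
    refine (Complex.re_le_norm _).trans ((ω.le_opNorm _).trans ?_)
    refine mul_le_of_le_one_right (norm_nonneg _) ((opNorm_comp_le _ _).trans ?_)
    exact mul_le_one₀ (norm_sum_rankOne_le (basis H).orthonormal F) (norm_nonneg _) hW
  calc _ ≤ ∑ i ∈ F, ((⟪basis H i, W (T (basis H i))⟫_ℂ).re + η / (F.card + 1)) :=
        Finset.sum_le_sum fun i _ => h1 i
    _ ≤ ‖ω‖ + F.card * (η / (F.card + 1)) := by
        rw [Finset.sum_add_distrib, Finset.sum_const, nsmul_eq_mul]; gcongr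
    _ ≤ ‖ω‖ + η := by
        gcongr
        rw [← mul_div_assoc, div_le_iff₀ (by positivity)]
        nlinarith

/-! ### Sums of rank-one operators and their traces -/

omit [CompleteSpace H] in
theorem hasSum_norm_inner_sq {ι : Type*} (h : HilbertBasis ι ℂ H) (x : H) :
    HasSum (fun k => ‖⟪h k, x⟫_ℂ‖ ^ 2) (‖x‖ ^ 2) := by
  have h1 := (h.hasSum_inner_mul_inner x x).mapL Complex.reCLM
  convert h1 using 1
  · funext k
    rw [← inner_conj_symm x (h k), Complex.conj_mul', ← Complex.ofReal_pow]; rfl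
  · exact (inner_self_eq_norm_sq (𝕜 := ℂ) x).symm

/-- If `T = ∑ⱼ |rⱼ⟩⟨rⱼ|` with `∑ⱼ ‖rⱼ‖² < ∞`, then `tr (T A) = ∑ⱼ ⟨rⱼ, A rⱼ⟩`, whichever Hilbert basis
computes the trace. -/
theorem hasSum_trace_comp_of_hasSum_rankOne {ι κ : Type*} (h : HilbertBasis κ ℂ H)
    {r : ι → H} {T : H →L[ℂ] H}
    (hr : Summable fun j => ‖r j‖ ^ 2) (hT : HasSum (fun j => rankOne ℂ (r j) (r j)) T)
    (A : H →L[ℂ] H) :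
    (Summable fun j => ⟪r j, A (r j)⟫_ℂ) ∧
    HasSum (fun k => ⟪h k, (T ∘L A) (h k)⟫_ℂ) (∑' j, ⟪r j, A (r j)⟫_ℂ) := by
  let f : ι × κ → ℂ :=
    fun p => ⟪adjoint A (r p.1), h p.2⟫_ℂ * ⟪h p.2, r p.1⟫_ℂ
  have hsq : ∀ B : H →L[ℂ] H, Summable fun p : ι × κ => ‖⟪h p.2, B (r p.1)⟫_ℂ‖ ^ 2 := by
    intro B
    refine (summable_prod_of_nonneg fun p => sq_nonneg _).2
      ⟨fun j => (hasSum_norm_inner_sq h (B (r j))).summable, ?_⟩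
    simp only [(hasSum_norm_inner_sq h _).tsum_eq]
    refine (hr.mul_left (‖B‖ ^ 2)).of_nonneg_of_le (fun j => sq_nonneg _) fun j => ?_
    rw [← mul_pow]
    gcongr
    exact B.le_opNorm _
  -- Both factors of `f` are square-summable over all pairs, so `f` is absolutely summable.
  have hfs : Summable f := by
    refine Summable.of_norm_bounded ((hsq (adjoint A)).add (hsq (.id ℂ H))) fun p => ?_
    change ‖⟪adjoint A (r p.1), h p.2⟫_ℂ * ⟪h p.2, r p.1⟫_ℂ‖ ≤ _
    rw [norm_mul, norm_inner_symm]
    simp only [id_apply]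
    nlinarith [sq_nonneg (‖⟪h p.2, adjoint A (r p.1)⟫_ℂ‖ - ‖⟪h p.2, r p.1⟫_ℂ‖),
      sq_nonneg ‖⟪h p.2, adjoint A (r p.1)⟫_ℂ‖, sq_nonneg ‖⟪h p.2, r p.1⟫_ℂ‖]
  have hrow : ∀ j, HasSum (fun k => f (j, k)) ⟪r j, A (r j)⟫_ℂ := fun j => by
    have h1 : ⟪adjoint A (r j), r j⟫_ℂ = ⟪r j, A (r j)⟫_ℂ := adjoint_inner_left A _ _
    have h2 := h.hasSum_inner_mul_inner (adjoint A (r j)) (r j)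
    rw [h1] at h2
    simpa only [f] using h2
  -- Summing over `j` first gives the diagonal of `T A`, over `k` first the inner products with `A`.
  have hcol : ∀ k, HasSum (fun j => f (j, k)) ⟪h k, (T ∘L A) (h k)⟫_ℂ := fun k => by
    have h1 := (hT.mapL (ContinuousLinearMap.apply ℂ H (A (h k)))).mapL (innerSL ℂ (h k))
    refine HasSum.congr_fun h1 fun j => ?_
    simp [f, adjoint_inner_left]
  have h1 := hfs.hasSum.prod_fiberwise hrow
  rw [h1.tsum_eq]
  exact ⟨h1.summable, (Equiv.prodComm _ _).hasSum_iff.2 hfs.hasSum |>.prod_fiberwise hcol⟩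

/-- A positive operator of trace `t` is a norm-convergent sum `∑ᵢ |rᵢ⟩⟨rᵢ|` with `∑ᵢ ‖rᵢ‖² = t`, where
`rᵢ = √T eᵢ`. -/
theorem exists_hasSum_rankOne {T : H →L[ℂ] H} (hT : T.IsPositive) {t : ℝ}
    (ht : HasSum (fun i => (⟪basis H i, T (basis H i)⟫_ℂ).re) t) :
    ∃ r : basisIndex H → H, HasSum (fun i => ‖r i‖ ^ 2) t ∧
      HasSum (fun i => rankOne ℂ (r i) (r i)) T := by
  have hT0 : 0 ≤ T := (nonneg_iff_isPositive T).2 hT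
  set R := CFC.sqrt T
  have hRR : R * R = T := CFC.sqrt_mul_sqrt_self T hT0
  have hRsa : adjoint R = R := (CFC.sqrt_nonneg T).isSelfAdjoint
  have key : ∀ x y, ⟪x, T y⟫_ℂ = ⟪R x, R y⟫_ℂ := fun x y => by
    rw [← hRR, ← adjoint_inner_right, hRsa]; rfl
  have hn : ∀ i, (⟪basis H i, T (basis H i)⟫_ℂ).re = ‖R (basis H i)‖ ^ 2 := fun i => by
    rw [key, ← inner_self_eq_norm_sq (𝕜 := ℂ)]; rfl
  simp only [hn] at ht
  refine ⟨fun i => R (basis H i), ht, ?_⟩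
  have hs : Summable fun i => rankOne ℂ (R (basis H i)) (R (basis H i)) := by
    refine Summable.of_norm ?_
    simpa [sq] using ht.summable
  convert hs.hasSum using 1
  ext y
  refine ext_inner_left ℂ fun x => ?_
  have h1 := (hs.hasSum.mapL (ContinuousLinearMap.apply ℂ H y)).mapL (innerSL ℂ x)
  have h2 := (basis H).hasSum_inner_mul_inner (R x) (R y)
  rw [key]
  refine h2.unique ?_
  refine HasSum.congr_fun h1 fun i => ?_
  have h3 : ∀ a b, ⟪R a, b⟫_ℂ = ⟪a, R b⟫_ℂ := fun a b => by
    rw [← adjoint_inner_right, hRsa]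
  simp [h3, mul_comm]

omit [CompleteSpace H] in
theorem norm_tsum_inner_le {ι : Type*} {r : ι → H} {t : ℝ} (hr : HasSum (fun j => ‖r j‖ ^ 2) t)
    (A : H →L[ℂ] H) : ‖∑' j, ⟪r j, A (r j)⟫_ℂ‖ ≤ ‖A‖ * t := by
  refine tsum_of_norm_bounded (hr.mul_left ‖A‖) fun j => ?_
  refine (norm_inner_le_norm _ _).trans ?_
  nlinarith [A.le_opNorm (r j), norm_nonneg (r j)]

/-- The trace duality bound `|tr (T A)| ≤ ‖A‖ ‖T‖₁` for self-adjoint `T`, from the decomposition into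
positive and negative parts. -/
theorem norm_trace_comp_le {T : H →L[ℂ] H} (hT : IsSelfAdjoint T) (hfin : traceNorm T ≠ ∞)
    {A : H →L[ℂ] H} {s : ℂ}
    (hs : HasSum (fun k => ⟪basis H k, (T ∘L A) (basis H k)⟫_ℂ) s) :
    ‖s‖ ≤ ‖A‖ * (traceNorm T).toReal := by
  have hp : (T⁺).IsPositive := (nonneg_iff_isPositive _).1 (CFC.posPart_nonneg T)
  have hn : (T⁻).IsPositive := (nonneg_iff_isPositive _).1 (CFC.negPart_nonneg T)
  have hp0 : ∀ i, 0 ≤ (⟪basis H i, T⁺ (basis H i)⟫_ℂ).re := fun i => hp.re_inner_nonneg_right (basis H i)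
  have hn0 : ∀ i, 0 ≤ (⟪basis H i, T⁻ (basis H i)⟫_ℂ).re := fun i => hn.re_inner_nonneg_right (basis H i)
  have hab : ∀ i, (⟪basis H i, CFC.abs T (basis H i)⟫_ℂ).re =
      (⟪basis H i, T⁺ (basis H i)⟫_ℂ).re + (⟪basis H i, T⁻ (basis H i)⟫_ℂ).re := fun i => by
    rw [← CFC.posPart_add_negPart T hT, add_apply, inner_add_right, Complex.add_re]
  have hsum : Summable fun i => (⟪basis H i, CFC.abs T (basis H i)⟫_ℂ).re := by
    have := ENNReal.summable_toReal hfin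
    refine this.congr fun i => ENNReal.toReal_ofReal ?_
    rw [hab]; exact add_nonneg (hp0 i) (hn0 i)
  have hps := hsum.of_nonneg_of_le hp0 fun i => by rw [hab]; exact le_add_of_nonneg_right (hn0 i)
  have hns := hsum.of_nonneg_of_le hn0 fun i => by rw [hab]; exact le_add_of_nonneg_left (hp0 i)
  have htr : (traceNorm T).toReal = (∑' i, (⟪basis H i, T⁺ (basis H i)⟫_ℂ).re) +
      ∑' i, (⟪basis H i, T⁻ (basis H i)⟫_ℂ).re := by
    rw [← hps.tsum_add hns, traceNorm, ← ENNReal.ofReal_tsum_of_nonneg _ hsum,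
      ENNReal.toReal_ofReal]
    · simp only [hab]
    · exact tsum_nonneg fun i => by rw [hab]; exact add_nonneg (hp0 i) (hn0 i)
    · intro i; rw [hab]; exact add_nonneg (hp0 i) (hn0 i)
  obtain ⟨r, hr, hrT⟩ := exists_hasSum_rankOne hp hps.hasSum
  obtain ⟨q, hq, hqT⟩ := exists_hasSum_rankOne hn hns.hasSum
  have h1 := (hasSum_trace_comp_of_hasSum_rankOne (basis H) hr.summable hrT A).2
  have h2 := (hasSum_trace_comp_of_hasSum_rankOne (basis H) hq.summable hqT A).2
  have h3 : s = _ := hs.unique ((h1.sub h2).congr_fun fun k => by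
    rw [← inner_sub_right, ← sub_apply, ← sub_comp, CFC.posPart_sub_negPart T hT])
  rw [h3, htr, mul_add]
  exact (norm_sub_le _ _).trans (add_le_add (norm_tsum_inner_le hr A) (norm_tsum_inner_le hq A))

theorem isSelfAdjoint_of_hasSum_rankOne {ι : Type*} {r : ι → H} {T : H →L[ℂ] H}
    (hT : HasSum (fun j => rankOne ℂ (r j) (r j)) T) : IsSelfAdjoint T := by
  refine HasSum.unique (f := fun j => rankOne ℂ (r j) (r j)) ?_ hT
  refine hT.star.congr_fun fun j => ?_
  rw [star_eq_adjoint, adjoint_rankOne]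

theorem IsState.exists_hasSum_rankOne {ρ : H →L[ℂ] H} (hρ : IsState ρ) :
    ∃ r : basisIndex H → H, HasSum (fun i => ‖r i‖ ^ 2) 1 ∧
      HasSum (fun i => rankOne ℂ (r i) (r i)) ρ :=
  QuantumSystem.exists_hasSum_rankOne hρ.isPositive (hρ.hasSum_trace.mapL Complex.reCLM)

/-! ### Bounds on `tr (τ A)` under convex combinations and trace norm limits -/

/-- The self-adjoint operators `τ` for which the diagonal of `τ A` is summable, with
`Re tr (τ A) ≤ c`. Summability is part of the definition because `trace` is a `tsum`. -/
def traceHalfSpace (A : H →L[ℂ] H) (c : ℝ) : Set (H →L[ℂ] H) :=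
  {τ | IsSelfAdjoint τ ∧
    ∃ s, HasSum (fun k => ⟪basis H k, (τ ∘L A) (basis H k)⟫_ℂ) s ∧ s.re ≤ c}

theorem mem_traceHalfSpace_of_hasSum_rankOne {ι : Type*} {r : ι → H} {T : H →L[ℂ] H}
    (hr : Summable fun j => ‖r j‖ ^ 2) (hT : HasSum (fun j => rankOne ℂ (r j) (r j)) T)
    (A : H →L[ℂ] H) {w : ι → ℝ} {c : ℝ} (hw : HasSum w c)
    (hle : ∀ j, (⟪r j, A (r j)⟫_ℂ).re ≤ w j) : T ∈ traceHalfSpace A c := by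
  obtain ⟨hs, htr⟩ := hasSum_trace_comp_of_hasSum_rankOne (basis H) hr hT A
  exact ⟨isSelfAdjoint_of_hasSum_rankOne hT, _, htr,
    hasSum_le hle (hs.hasSum.mapL Complex.reCLM) hw⟩

theorem convex_traceHalfSpace (A : H →L[ℂ] H) (c : ℝ) : Convex ℝ (traceHalfSpace A c) := by
  rintro τ ⟨hτ, s, hs, hsA⟩ σ ⟨hσ, t, ht, htA⟩ p q hp hq hpq
  refine ⟨((IsSelfAdjoint.all p).smul hτ).add ((IsSelfAdjoint.all q).smul hσ),
    p * s + q * t, ?_, ?_⟩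
  · refine ((hs.mul_left (p : ℂ)).add (ht.mul_left (q : ℂ))).congr_fun fun k => ?_
    simp only [comp_apply, add_apply, smul_apply, inner_add_right]
    rw [← Complex.coe_smul, ← Complex.coe_smul, inner_smul_right, inner_smul_right]
  · rw [Complex.add_re, Complex.re_ofReal_mul, Complex.re_ofReal_mul]
    calc p * s.re + q * t.re ≤ p * c + q * c := by gcongr
      _ = c := by rw [← add_mul, hpq, one_mul]

/-- The bound `Re tr (τ A) ≤ c` passes from a set `P` to its convex hull and to those states that are
trace norm limits of this hull. -/
theorem re_trace_comp_le_of_forall_traceNorm_lt {ρ A : H →L[ℂ] H} {c : ℝ} (hstate : IsState ρ)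
    {P : Set (H →L[ℂ] H)} (hP : P ⊆ traceHalfSpace A c)
    (happ : ∀ ε : ℝ≥0∞, 0 < ε → ∃ τ ∈ convexHull ℝ P, traceNorm (ρ - τ) < ε) :
    (trace (ρ ∘L A)).re ≤ c := by
  obtain ⟨r, hr, hrρ⟩ := hstate.exists_hasSum_rankOne
  have h1 := (hasSum_trace_comp_of_hasSum_rankOne (basis H) hr.summable hrρ A).2
  rw [trace, h1.tsum_eq]
  refine le_of_forall_pos_le_add fun η hη => ?_
  obtain ⟨τ, hτ, hτρ⟩ := happ (ENNReal.ofReal (η / (‖A‖ + 1)))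
    (ENNReal.ofReal_pos.2 (by positivity))
  obtain ⟨hτsa, s, hs, hsA⟩ := convexHull_min hP (convex_traceHalfSpace A c) hτ
  have h2 := norm_trace_comp_le (hstate.isPositive.isSelfAdjoint.sub hτsa) hτρ.ne_top
    (A := A) ((h1.sub hs).congr_fun fun k => by
      rw [sub_comp, sub_apply, inner_sub_right])
  have h3 : (traceNorm (ρ - τ)).toReal ≤ η / (‖A‖ + 1) :=
    ENNReal.toReal_le_of_le_ofReal (by positivity) hτρ.le
  have h4 : ‖A‖ * (traceNorm (ρ - τ)).toReal ≤ η := by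
    calc _ ≤ (‖A‖ + 1) * (η / (‖A‖ + 1)) := by gcongr; linarith
      _ = η := by field_simp
  have h5 := (Complex.re_le_norm _).trans (h2.trans h4)
  rw [Complex.sub_re] at h5
  linarith

/-! ### Vector functionals on the bounded operators -/

omit [CompleteSpace H] in
variable (H) in
/-- The functional `B ↦ ⟨y, B x⟩` on the bounded operators, linear in `x` and conjugate-linear in `y`. -/
noncomputable def vecFunctional : H →L[ℂ] H →L⋆[ℂ] StrongDual ℂ (H →L[ℂ] H) :=
  LinearMap.mkContinuous₂ (LinearMap.mk₂'ₛₗ (RingHom.id ℂ) (starRingEnd ℂ)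
    (fun x y => (innerSL ℂ y) ∘L (ContinuousLinearMap.apply ℂ H x))
    (by intros; ext; simp) (by intros; ext; simp) (by intros; ext; simp) (by intros; ext; simp))
    1 (fun x y => by
      refine opNorm_le_bound _ (by positivity) fun B => ?_
      refine (norm_inner_le_norm (𝕜 := ℂ) y (B x)).trans ?_
      calc ‖y‖ * ‖B x‖ ≤ ‖y‖ * (‖B‖ * ‖x‖) := by gcongr; exact B.le_opNorm x
        _ = _ := by ring)

@[simp]
theorem vecFunctional_apply (x y : H) (B : H →L[ℂ] H) : vecFunctional H x y B = ⟪y, B x⟫_ℂ := rfl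

theorem norm_vecFunctional_le (x y : H) : ‖vecFunctional H x y‖ ≤ ‖x‖ * ‖y‖ := by
  refine opNorm_le_bound _ (by positivity) fun B => ?_
  refine (norm_inner_le_norm (𝕜 := ℂ) y (B x)).trans ?_
  calc ‖y‖ * ‖B x‖ ≤ ‖y‖ * (‖B‖ * ‖x‖) := by gcongr; exact B.le_opNorm x
    _ = _ := by ring

theorem isState_rankOne {a : H} (ha : ‖a‖ = 1) : IsState (rankOne ℂ a a) where
  isPositive := isPositive_rankOne_self a
  hasSum_trace := by
    have h1 := (basis H).hasSum_inner_mul_inner a a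
    rw [inner_self_eq_norm_sq_to_K, ha] at h1
    simpa using h1

theorem represents_vecFunctional (x : H) : Represents (vecFunctional H x x) (rankOne ℂ x x) := by
  intro a b
  simp [mul_comm]

/-- A continuous functional on the dual of the bounded operators restricts, along the functionals
`B ↦ ⟨y, B x⟩`, to a bounded sesquilinear form, which is given by an operator. -/
theorem exists_operator_of_bidual (F : StrongDual ℂ (StrongDual ℂ (H →L[ℂ] H))) :
    ∃ A : H →L[ℂ] H, ∀ x y, ⟪y, A x⟫_ℂ = F (vecFunctional H x y) := by
  let B : H →L⋆[ℂ] H →L[ℂ] ℂ := ((ContinuousLinearMap.compL ℂ H _ ℂ F).comp (vecFunctional H).flip)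
  refine ⟨adjoint (continuousLinearMapOfBilin B), fun x y => ?_⟩
  rw [adjoint_inner_right, continuousLinearMapOfBilin_apply]
  rfl

omit [CompleteSpace H] in
theorem convex_setOf_represents {K : Set (H →L[ℂ] H)} (hK : Convex ℝ K) :
    Convex ℝ {ω : StrongDual ℂ (H →L[ℂ] H) | ∃ τ ∈ K, Represents ω τ} := by
  rintro ω ⟨τ, hτ, h⟩ ω' ⟨τ', hτ', h'⟩ p q hp hq hpq
  refine ⟨p • τ + q • τ', hK hτ hτ' hp hq hpq, fun x y => ?_⟩
  simp only [add_apply, smul_apply, inner_add_right]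
  rw [h, h', ← Complex.coe_smul p (τ x), ← Complex.coe_smul q (τ' x), inner_smul_right,
    inner_smul_right, Complex.real_smul, Complex.real_smul]

end Hilbert

section Bipartite

variable {HA : Type u} {HB : Type v}
  [NormedAddCommGroup HA] [InnerProductSpace ℂ HA]
  [NormedAddCommGroup HB] [InnerProductSpace ℂ HB]

/-! ### Product vectors and tensor products of operators -/

theorem norm_prodVec (a : HA) (b : HB) : ‖prodVec a b‖ = ‖a‖ * ‖b‖ := by
  rw [prodVec, UniformSpace.Completion.norm_coe, TensorProduct.norm_tmul]

theorem inner_prodVec (a a' : HA) (b b' : HB) :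
    ⟪prodVec a b, prodVec a' b'⟫_ℂ = ⟪a, a'⟫_ℂ * ⟪b, b'⟫_ℂ := by
  rw [prodVec, prodVec, UniformSpace.Completion.inner_coe, TensorProduct.inner_tmul]

theorem tensorOp_prodVec (S : HA →L[ℂ] HA) (T : HB →L[ℂ] HB) (a : HA) (b : HB) :
    tensorOp S T (prodVec a b) = prodVec (S a) (T b) := by
  simp [tensorOp, prodVec]

/-- Bounded operators that agree on product vectors are equal, as these vectors span a dense subspace. -/
theorem ext_prodVec {S T : HilbertTensor HA HB →L[ℂ] HilbertTensor HA HB}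
    (h : ∀ a b, S (prodVec a b) = T (prodVec a b)) : S = T := by
  refine ContinuousLinearMap.ext fun x => ?_
  induction x using UniformSpace.Completion.induction_on with
  | hp => exact isClosed_eq S.continuous T.continuous
  | ih x =>
    induction x using TensorProduct.induction_on with
    | zero => rw [UniformSpace.Completion.coe_zero, map_zero, map_zero]
    | tmul a b => exact h a b
    | add x y hx hy => rw [UniformSpace.Completion.coe_add, map_add, map_add, hx, hy]

theorem prodVec_smul_smul (c d : ℂ) (a : HA) (b : HB) :
    prodVec (c • a) (d • b) = (c * d) • prodVec a b := by
  rw [prodVec, TensorProduct.smul_tmul_smul, UniformSpace.Completion.coe_smul]; rfl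

theorem tensorOp_rankOne (a : HA) (b : HB) :
    tensorOp (rankOne ℂ a a) (rankOne ℂ b b) = rankOne ℂ (prodVec a b) (prodVec a b) :=
  ext_prodVec fun x y => by
    rw [tensorOp_prodVec]
    simp only [rankOne_apply, inner_prodVec, prodVec_smul_smul]

/-- The map `(a, b) ↦ a ⊗ b` into the Hilbert space tensor product as a continuous bilinear map. -/
noncomputable def prodVecL : HA →L[ℂ] HB →L[ℂ] HilbertTensor HA HB :=
  LinearMap.mkContinuous₂ (LinearMap.mk₂ ℂ prodVec
    (fun _ _ _ => by
      rw [prodVec, TensorProduct.add_tmul, UniformSpace.Completion.coe_add]; rfl)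
    (fun c a b => by simpa using prodVec_smul_smul c 1 a b)
    (fun _ _ _ => by
      rw [prodVec, TensorProduct.tmul_add, UniformSpace.Completion.coe_add]; rfl)
    (fun c a b => by simpa using prodVec_smul_smul 1 c a b)) 1
    (fun a b => by rw [LinearMap.mk₂_apply, norm_prodVec, one_mul])

/-- The tensor product of `∑ᵢ |aᵢ⟩⟨aᵢ|` and `∑ⱼ |bⱼ⟩⟨bⱼ|` is `∑ᵢⱼ |aᵢ ⊗ bⱼ⟩⟨aᵢ ⊗ bⱼ|`. -/
theorem hasSum_rankOne_tensorOp [CompleteSpace HA] [CompleteSpace HB] {ι κ : Type*}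
    {a : ι → HA} {b : κ → HB} {S : HA →L[ℂ] HA}
    {T : HB →L[ℂ] HB} (ha : Summable fun i => ‖a i‖ ^ 2) (hb : Summable fun j => ‖b j‖ ^ 2)
    (hS : HasSum (fun i => rankOne ℂ (a i) (a i)) S)
    (hT : HasSum (fun j => rankOne ℂ (b j) (b j)) T) :
    (Summable fun p : ι × κ => ‖prodVec (a p.1) (b p.2)‖ ^ 2) ∧
    HasSum (fun p : ι × κ => rankOne ℂ (prodVec (a p.1) (b p.2)) (prodVec (a p.1) (b p.2)))
      (tensorOp S T) := by
  have h1 : Summable fun p : ι × κ => ‖prodVec (a p.1) (b p.2)‖ ^ 2 := by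
    simp only [norm_prodVec, mul_pow]
    exact ha.mul_of_nonneg hb (fun _ => sq_nonneg _) fun _ => sq_nonneg _
  have h2 : Summable fun p : ι × κ =>
      rankOne ℂ (prodVec (a p.1) (b p.2)) (prodVec (a p.1) (b p.2)) :=
    Summable.of_norm (by simpa [sq] using h1)
  refine ⟨h1, ?_⟩
  convert h2.hasSum using 1
  refine ext_prodVec fun x y => ?_
  have h3 := h2.hasSum.mapL (ContinuousLinearMap.apply ℂ _ (prodVec x y))
  have hSx := hS.mapL (ContinuousLinearMap.apply ℂ _ x)
  have hTy := hT.mapL (ContinuousLinearMap.apply ℂ _ y)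
  have hrow : ∀ i, HasSum (fun j => ContinuousLinearMap.apply ℂ _ (prodVec x y)
      (rankOne ℂ (prodVec (a i) (b j)) (prodVec (a i) (b j))))
      (prodVec (rankOne ℂ (a i) (a i) x) (T y)) := fun i => by
    refine (hTy.mapL (prodVecL (rankOne ℂ (a i) (a i) x))).congr_fun fun j => ?_
    rw [← tensorOp_rankOne]
    exact tensorOp_prodVec _ _ x y
  have hcol : HasSum (fun i => prodVec (rankOne ℂ (a i) (a i) x) (T y)) (prodVec (S x) (T y)) :=
    hSx.mapL (prodVecL.flip (T y))
  rw [tensorOp_prodVec]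
  exact hcol.unique (h3.prod_fiberwise hrow)

/-! ### Separable states satisfy every witness inequality -/

theorem re_inner_prodVec_le_of_norm_eq_one (A : HilbertTensor HA HB →L[ℂ] HilbertTensor HA HB)
    {a : HA} {b : HB} (ha : ‖a‖ = 1) (hb : ‖b‖ = 1) :
    (⟪prodVec a b, A (prodVec a b)⟫_ℂ).re ≤ fAB A := by
  refine le_csSup ⟨‖A‖, ?_⟩ ⟨a, b, ha, hb, rfl⟩
  rintro _ ⟨a, b, ha, hb, rfl⟩
  have h1 : ‖prodVec a b‖ = 1 := by rw [norm_prodVec, ha, hb, one_mul]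
  refine (Complex.re_le_norm _).trans ((norm_inner_le_norm _ _).trans ?_)
  rw [h1, one_mul]
  simpa [h1] using A.le_opNorm (prodVec a b)

/-- The homogeneous form of the bound by `f_AB(A)`, for vectors that need not be normalized. -/
theorem re_inner_prodVec_le (A : HilbertTensor HA HB →L[ℂ] HilbertTensor HA HB)
    (a : HA) (b : HB) :
    (⟪prodVec a b, A (prodVec a b)⟫_ℂ).re ≤ fAB A * (‖a‖ ^ 2 * ‖b‖ ^ 2) := by
  rcases eq_or_ne a 0 with rfl | ha
  · have h0 : prodVec (0 : HA) b = 0 := by rw [← norm_eq_zero, norm_prodVec, norm_zero, zero_mul]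
    simp [h0]
  rcases eq_or_ne b 0 with rfl | hb
  · have h0 : prodVec a (0 : HB) = 0 := by rw [← norm_eq_zero, norm_prodVec, norm_zero, mul_zero]
    simp [h0]
  have ha' := norm_ne_zero_iff.2 ha
  have hb' := norm_ne_zero_iff.2 hb
  set x := prodVec (((‖a‖⁻¹ : ℝ) : ℂ) • a) (((‖b‖⁻¹ : ℝ) : ℂ) • b) with hx
  have h1 := re_inner_prodVec_le_of_norm_eq_one A (a := ((‖a‖⁻¹ : ℝ) : ℂ) • a)
    (b := ((‖b‖⁻¹ : ℝ) : ℂ) • b) (by simp [norm_smul, ha']) (by simp [norm_smul, hb'])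
  have h2 : prodVec a b = ((‖a‖ * ‖b‖ : ℝ) : ℂ) • x := by
    rw [hx, prodVec_smul_smul, smul_smul, ← Complex.ofReal_mul, ← Complex.ofReal_mul]
    rw [show ‖a‖ * ‖b‖ * (‖a‖⁻¹ * ‖b‖⁻¹) = 1 by field_simp, Complex.ofReal_one, one_smul]
  rw [h2, map_smul, inner_smul_left, inner_smul_right, Complex.conj_ofReal,
    Complex.re_ofReal_mul, Complex.re_ofReal_mul]
  calc _ = (⟪x, A x⟫_ℂ).re * (‖a‖ ^ 2 * ‖b‖ ^ 2) := by ring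
    _ ≤ _ := by gcongr

variable [CompleteSpace HA] [CompleteSpace HB]

theorem productStates_subset_traceHalfSpace
    (A : HilbertTensor HA HB →L[ℂ] HilbertTensor HA HB) :
    productStates HA HB ⊆ traceHalfSpace A (fAB A) := by
  rintro τ ⟨ρA, ρB, hρA, hρB, rfl⟩
  obtain ⟨a, ha, haρ⟩ := hρA.exists_hasSum_rankOne
  obtain ⟨b, hb, hbρ⟩ := hρB.exists_hasSum_rankOne
  obtain ⟨hs, hr⟩ := hasSum_rankOne_tensorOp ha.summable hb.summable haρ hbρ
  have h1 : HasSum (fun p : basisIndex HA × basisIndex HB => ‖a p.1‖ ^ 2 * ‖b p.2‖ ^ 2) (1 * 1) :=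
    ha.mul hb (ha.summable.mul_of_nonneg hb.summable (fun _ => sq_nonneg _) fun _ => sq_nonneg _)
  have h2 := h1.mul_left (fAB A)
  rw [mul_one, mul_one] at h2
  exact mem_traceHalfSpace_of_hasSum_rankOne hs hr A h2 fun p => re_inner_prodVec_le A _ _

/-- No operator `A` detects a separable state: `Re tr (ρ A) ≤ f_AB(A)`. -/
theorem IsSeparable.re_trace_comp_le {ρ : HilbertTensor HA HB →L[ℂ] HilbertTensor HA HB}
    (hρ : IsSeparable ρ) (A : HilbertTensor HA HB →L[ℂ] HilbertTensor HA HB) :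
    (trace (ρ ∘L A)).re ≤ fAB A :=
  re_trace_comp_le_of_forall_traceNorm_lt hρ.1 (productStates_subset_traceHalfSpace A) hρ.2

/-! ### Existence of a witness for an entangled state -/

/-- A convex combination of the functionals of unit product vectors represents the corresponding
convex combination of product states. -/
theorem exists_represents_of_mem_convexHull
    {ω : StrongDual ℂ (HilbertTensor HA HB →L[ℂ] HilbertTensor HA HB)}
    (hω : ω ∈ convexHull ℝ {ω | ∃ (a : HA) (b : HB), ‖a‖ = 1 ∧ ‖b‖ = 1 ∧
      ω = vecFunctional _ (prodVec a b) (prodVec a b)}) :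
    ∃ τ ∈ convexHull ℝ (productStates HA HB), Represents ω τ := by
  refine convexHull_min ?_ (convex_setOf_represents (convex_convexHull ℝ (productStates HA HB))) hω
  rintro _ ⟨a, b, ha, hb, rfl⟩
  refine ⟨_, subset_convexHull ℝ _ ⟨_, _, isState_rankOne ha, isState_rankOne hb, rfl⟩, ?_⟩
  rw [tensorOp_rankOne]
  exact represents_vecFunctional _

omit [CompleteSpace HA] [CompleteSpace HB] in
/-- If the tensor product carries a state, then both factors are nonzero. Hence the supremum in `fAB` is
over a nonempty set. -/
theorem IsState.exists_norm_eq_one {ρ : HilbertTensor HA HB →L[ℂ] HilbertTensor HA HB}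
    (hρ : IsState ρ) : (∃ a : HA, ‖a‖ = 1) ∧ ∃ b : HB, ‖b‖ = 1 := by
  have h0 : ∃ a b, prodVec (a : HA) (b : HB) ≠ 0 := by
    by_contra! h
    have : ρ = 0 := ext_prodVec fun a b => by rw [h, map_zero, zero_apply]
    have h1 := hρ.hasSum_trace
    simp only [this, zero_apply, inner_zero_right] at h1
    exact zero_ne_one (hasSum_zero.unique h1)
  obtain ⟨a, b, hab⟩ := h0
  have h2 : ‖a‖ * ‖b‖ ≠ 0 := by rwa [← norm_prodVec, norm_ne_zero_iff]
  have ha : a ≠ 0 := norm_ne_zero_iff.1 (left_ne_zero_of_mul h2)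
  have hb : b ≠ 0 := norm_ne_zero_iff.1 (right_ne_zero_of_mul h2)
  exact ⟨⟨((‖a‖⁻¹ : ℝ) : ℂ) • a, by simp [norm_smul, ha]⟩,
    ⟨((‖b‖⁻¹ : ℝ) : ℂ) • b, by simp [norm_smul, hb]⟩⟩

/-- Hahn-Banach separation of the functional of an entangled state from those of the product vectors
yields a witness. -/
theorem IsEntangled.exists_witness {ρ : HilbertTensor HA HB →L[ℂ] HilbertTensor HA HB}
    (hρ : IsEntangled ρ) : ∃ A : HilbertTensor HA HB →L[ℂ] HilbertTensor HA HB,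
      IsSelfAdjoint A ∧ fAB A < (trace (ρ ∘L A)).re := by
  obtain ⟨hstate, hnsep⟩ := hρ
  obtain ⟨r, hr, hrρ⟩ := hstate.exists_hasSum_rankOne
  set S : Set (StrongDual ℂ (HilbertTensor HA HB →L[ℂ] HilbertTensor HA HB)) :=
    {ω | ∃ (a : HA) (b : HB), ‖a‖ = 1 ∧ ‖b‖ = 1 ∧
      ω = vecFunctional _ (prodVec a b) (prodVec a b)}
  have hsum : Summable fun j => vecFunctional (HilbertTensor HA HB) (r j) (r j) :=
    Summable.of_norm_bounded hr.summable fun j =>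
      (norm_vecFunctional_le _ _).trans_eq (sq _).symm
  set ωρ := ∑' j, vecFunctional (HilbertTensor HA HB) (r j) (r j)
  have hrep : Represents ωρ ρ := fun x y => by
    have h1 := hsum.hasSum.mapL (ContinuousLinearMap.apply ℂ ℂ (rankOne ℂ x y))
    have h2 := (hrρ.mapL (ContinuousLinearMap.apply ℂ _ x)).mapL (innerSL ℂ y)
    refine h1.unique (h2.congr_fun fun j => ?_)
    simp [mul_comm]
  -- An approximation of `ωρ` in norm by convex combinations approximates `ρ` in trace norm.
  have hnot : ωρ ∉ closure (convexHull ℝ S) := fun hmem => by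
    refine hnsep ⟨hstate, fun ε hε => ?_⟩
    obtain ⟨δ, hδ, hδε⟩ := ENNReal.lt_iff_exists_nnreal_btwn.1 hε
    obtain ⟨ω, hω, hdist⟩ := Metric.mem_closure_iff.1 hmem δ (by exact_mod_cast hδ)
    obtain ⟨τ, hτ, hωτ⟩ := exists_represents_of_mem_convexHull hω
    have h1 : Represents (ωρ - ω) (ρ - τ) := fun x y => by
      rw [sub_apply, sub_apply, inner_sub_right, hrep, hωτ]
    refine ⟨τ, hτ, h1.traceNorm_le.trans_lt (lt_of_le_of_lt ?_ hδε)⟩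
    rw [← ENNReal.ofReal_coe_nnreal]
    exact ENNReal.ofReal_le_ofReal (by rw [← dist_eq_norm]; exact hdist.le)
  obtain ⟨F, u, hF, hFρ⟩ := RCLike.geometric_hahn_banach_closed_point (𝕜 := ℂ)
    (convex_convexHull ℝ S).closure isClosed_closure hnot
  obtain ⟨B, hB⟩ := exists_operator_of_bidual F
  set A := (2⁻¹ : ℝ) • (B + adjoint B) with hA
  have hre : ∀ x, (⟪x, A x⟫_ℂ).re = (F (vecFunctional _ x x)).re := fun x => by
    have h1 : (⟪x, adjoint B x⟫_ℂ).re = (⟪x, B x⟫_ℂ).re := by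
      rw [adjoint_inner_right, ← inner_conj_symm, Complex.conj_re]
    rw [← hB, hA, smul_apply, ← Complex.coe_smul, inner_smul_right, Complex.re_ofReal_mul,
      add_apply, inner_add_right, Complex.add_re, h1]
    ring
  refine ⟨A, (IsSelfAdjoint.all _).smul (IsSelfAdjoint.add_star_self B), ?_⟩
  have hle : fAB A ≤ u := by
    obtain ⟨⟨a, ha⟩, b, hb⟩ := hstate.exists_norm_eq_one
    refine csSup_le ⟨_, a, b, ha, hb, rfl⟩ ?_
    rintro _ ⟨a, b, ha, hb, rfl⟩
    rw [hre]
    exact (hF _ (subset_closure (subset_convexHull ℝ _ ⟨a, b, ha, hb, rfl⟩))).le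
  obtain ⟨hs, htr⟩ := hasSum_trace_comp_of_hasSum_rankOne (basis _) hr.summable hrρ A
  have heq : (trace (ρ ∘L A)).re = (F ωρ).re := by
    rw [trace, htr.tsum_eq]
    refine (hs.hasSum.mapL Complex.reCLM).unique ?_
    exact ((hsum.hasSum.mapL F).mapL Complex.reCLM).congr_fun fun j => hre (r j)
  rw [heq]
  exact hle.trans_lt hFρ

end Bipartite

end QuantumSystem

theorem theorem2 {HA : Type*} {HB : Type*}
    [NormedAddCommGroup HA] [InnerProductSpace ℂ HA] [CompleteSpace HA]
    [NormedAddCommGroup HB] [InnerProductSpace ℂ HB] [CompleteSpace HB]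
    (ρ : QuantumSystem.HilbertTensor HA HB →L[ℂ] QuantumSystem.HilbertTensor HA HB)
    (hρ : QuantumSystem.IsState ρ) :
    QuantumSystem.IsEntangled ρ ↔
      ∃ A : QuantumSystem.HilbertTensor HA HB →L[ℂ] QuantumSystem.HilbertTensor HA HB,
        IsSelfAdjoint A ∧
          QuantumSystem.fAB A < (QuantumSystem.trace (ρ ∘L A)).re := by
  refine ⟨fun h => h.exists_witness, ?_⟩
  rintro ⟨A, -, hA⟩
  exact ⟨hρ, fun hsep => hA.not_ge (hsep.re_trace_comp_le A)⟩
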